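/- By a local field we mean a field that is complete with respect to a nontrivial discrete valuation and has finite residue field (of either characteristic). Let $L/K$ be a finite cyclic Galois extension of local fields of degree $n$, with Galois group $G=\mathrm{Gal}(L/K)$, and let $U_L=\mathcal O_L^\times$ be the group of units of the valuation ring of $L$, viewed as a $G$-module. For a $G$-module $M$ let $H_T^r(G,M)$ denote Tate cohomology, and let $$h(M)=\frac{|H_T^0(G,M)|}{|H_T^1(G,M)|}$$ be its Herbrand quotient, which is defined when both groups are finite. Then the Herbrand quotients of $U_L$ and of $L^\times$ are defined, and $$h(U_L)=1,\qquad h(L^\times)=n .$$ In particular, $|H^2(G,L^\times)|=n$. -/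

import Mathlib

open ValuativeRel

universe u

namespace LocalFieldCohomology

section GaloisAction

variable {L : Type*} [Field L] [ValuativeRel L] [TopologicalSpace L]
  [IsNonarchimedeanLocalField L]

/-- In a local field there is an `m ≥ 2` such that every principal unit is an `m`-th power of a
principal unit. -/
theorem exists_principalUnit_root : ∃ m : ℕ, 2 ≤ m ∧ ∀ x : 𝒪[L], x - 1 ∈ 𝓂[L] →
    ∃ y : 𝒪[L], y - 1 ∈ 𝓂[L] ∧ y ^ m = x := by
  let := IsTopologicalAddGroup.rightUniformSpace L
  have := isUniformAddGroup_of_addCommGroup (G := L)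
  have : HenselianRing 𝒪[L] 𝓂[L] := inferInstance
  have h23 : ∃ m : ℕ, 2 ≤ m ∧ ((m : ℕ) : 𝒪[L]) ∉ 𝓂[L] := by
    by_contra! h
    have h2 := h 2 le_rfl
    have h3 := h 3 (by norm_num)
    have h1 : (1 : 𝒪[L]) ∈ 𝓂[L] := by
      have := Ideal.sub_mem _ h3 h2
      have e : (((3 : ℕ) : 𝒪[L]) - ((2 : ℕ) : 𝒪[L])) = 1 := by push_cast; ring
      rwa [e] at this
    exact (Ideal.ne_top_iff_one _).mp (IsLocalRing.maximalIdeal.isMaximal 𝒪[L]).ne_top h1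
  obtain ⟨m, hm, hm'⟩ := h23
  refine ⟨m, hm, fun x hx => ?_⟩
  have hu : IsUnit ((m : ℕ) : 𝒪[L]) := by
    by_contra hc
    exact hm' ((IsLocalRing.mem_maximalIdeal _).mpr hc)
  obtain ⟨y, hy, hy'⟩ := HenselianRing.is_henselian (I := 𝓂[L])
    (Polynomial.X ^ m - Polynomial.C x) (Polynomial.monic_X_pow_sub_C x (by omega)) 1
    (by
      have := neg_mem hx
      simpa using this)
    (by
      simpa [Polynomial.derivative_X_pow] using hu.map (Ideal.Quotient.mk 𝓂[L]))
  refine ⟨y, hy', ?_⟩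
  simpa [Polynomial.IsRoot, sub_eq_zero] using hy

/-- A valuation on a local field with value group `ℤ` is at most `1` on the maximal ideal. -/
theorem valuation_le_one_of_mem_maximalIdeal (w : Valuation L (WithZero (Multiplicative ℤ)))
    (a : 𝒪[L]) (ha : a ∈ 𝓂[L]) : w (a : L) ≤ 1 := by
  obtain ⟨m, hm, hroot⟩ := exists_principalUnit_root (L := L)
  have hpow : ∀ k : ℕ, ∀ x : 𝒪[L], x - 1 ∈ 𝓂[L] → ∃ y : 𝒪[L], y ^ m ^ k = x := by
    intro k
    induction k with
    | zero => exact fun x _ => ⟨x, by simp⟩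
    | succ k ih =>
      intro x hx
      obtain ⟨y, hy, rfl⟩ := hroot x hx
      obtain ⟨z, rfl⟩ := ih y hy
      exact ⟨z, by rw [pow_succ, pow_mul]⟩
  have hone : w ((1 + a : 𝒪[L]) : L) = 1 := by
    have hmem : (1 + a : 𝒪[L]) - 1 ∈ 𝓂[L] := by simpa using ha
    have hne : w ((1 + a : 𝒪[L]) : L) ≠ 0 := by
      intro h0
      have h0' : (1 + a : 𝒪[L]) = 0 := Subtype.ext ((map_eq_zero w).mp h0)
      rw [h0', zero_sub] at hmem
      exact (Ideal.ne_top_iff_one _).mp (IsLocalRing.maximalIdeal.isMaximal 𝒪[L]).ne_top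
        (by simpa using neg_mem hmem)
    have hdvd : ∀ k : ℕ, ((m : ℤ) ^ k) ∣ WithZero.log (w ((1 + a : 𝒪[L]) : L)) := by
      intro k
      obtain ⟨y, hy⟩ := hpow k _ hmem
      rw [← hy]
      refine ⟨WithZero.log (w (y : L)), ?_⟩
      push_cast
      rw [map_pow, WithZero.log_pow]
      simp
    have hlog : WithZero.log (w ((1 + a : 𝒪[L]) : L)) = 0 := by
      by_contra hc
      obtain ⟨k, hk⟩ := pow_unbounded_of_one_lt
        |WithZero.log (w ((1 + a : 𝒪[L]) : L))| (show (1 : ℤ) < m by exact_mod_cast hm)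
      have := Int.le_of_dvd (abs_pos.mpr hc) ((dvd_abs _ _).mpr (hdvd k))
      omega
    rw [← WithZero.exp_log hne, hlog, WithZero.exp_zero]
  have : (a : L) = ((1 + a : 𝒪[L]) : L) - 1 := by push_cast; ring
  rw [this]
  exact (w.map_sub _ _).trans (by rw [hone, map_one, max_self])

/-- A valuation on a local field with value group `ℤ` is at most `1` on the ring of integers. -/
theorem valuation_le_one_of_mem_integer (w : Valuation L (WithZero (Multiplicative ℤ)))
    (x : 𝒪[L]) : w (x : L) ≤ 1 := by
  by_contra! hx
  obtain ⟨a, ha, ha0⟩ : ∃ a ∈ 𝓂[L], a ≠ 0 :=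
    Submodule.exists_mem_ne_zero_of_ne_bot (IsDiscreteValuationRing.not_a_field 𝒪[L])
  have hwa : w (a : L) ≠ 0 := by
    rw [Ne, map_eq_zero]
    exact fun h => ha0 (Subtype.ext h)
  have hle : ∀ k : ℕ, w (a : L) * w (x : L) ^ k ≤ 1 := by
    intro k
    have := valuation_le_one_of_mem_maximalIdeal w (a * x ^ k) (Ideal.mul_mem_right _ _ ha)
    simpa using this
  obtain ⟨k, hk⟩ := MulArchimedean.arch (w (a : L))⁻¹ hx
  have h1 := hle (k + 1)
  have h2 : (w (a : L))⁻¹ < w (x : L) ^ (k + 1) :=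
    hk.trans_lt (pow_lt_pow_right₀ hx (Nat.lt_succ_self k))
  have h3 : 1 < w (a : L) * w (x : L) ^ (k + 1) := by
    calc (1 : WithZero (Multiplicative ℤ)) = w (a : L) * (w (a : L))⁻¹ := (mul_inv_cancel₀ hwa).symm
      _ < _ := (mul_lt_mul_iff_right₀ (zero_lt_iff.mpr hwa)).mpr h2
  exact absurd h1 (not_le.mpr h3)

/-- Field automorphisms of a local field preserve its ring of integers. -/
theorem map_mem_integer (σ : L →+* L) (x : 𝒪[L]) : σ (x : L) ∈ 𝒪[L] := by
  let e := IsNonarchimedeanLocalField.valueGroupWithZeroIsoInt L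
  let v : Valuation L (WithZero (Multiplicative ℤ)) :=
    (valuation L).map e.toMulEquiv.toMonoidWithZeroHom (OrderHomClass.mono e)
  have h := valuation_le_one_of_mem_integer (v.comap σ) x
  have h' : e (valuation L (σ (x : L))) ≤ e 1 := by
    rw [map_one]; exact h
  exact (Valuation.mem_integer_iff _ _).mpr (e.toOrderIso.le_iff_le.mp h')

/-- The natural action of the automorphisms of `L/K` on the ring of integers of a local field `L`,
by restriction of the action on `L`. -/
instance galoisActionInteger {K : Type*} [CommRing K] [Algebra K L] :
    MulSemiringAction Gal(L/K) 𝒪[L] where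
  smul σ x := ⟨σ x, map_mem_integer (σ : L →+* L) x⟩
  one_smul _ := rfl
  mul_smul _ _ _ := rfl
  smul_zero σ := Subtype.ext (map_zero σ)
  smul_add σ x y := Subtype.ext (map_add σ (x : L) y)
  smul_one σ := Subtype.ext (map_one σ)
  smul_mul σ x y := Subtype.ext (map_mul σ (x : L) y)

/-- The natural action of the automorphisms of `L/K` on the unit group `U_L = 𝒪[L]ˣ`. -/
noncomputable instance galoisActionUnits {K : Type*} [CommRing K] [Algebra K L] :
    MulDistribMulAction Gal(L/K) 𝒪[L]ˣ :=
  Units.mulDistribMulActionRight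

theorem coe_smul_integer {K : Type*} [CommRing K] [Algebra K L] (σ : Gal(L/K)) (x : 𝒪[L]) :
    ((σ • x : 𝒪[L]) : L) = σ x := rfl

theorem coe_smul_units {K : Type*} [CommRing K] [Algebra K L] (σ : Gal(L/K)) (x : 𝒪[L]ˣ) :
    (((σ • x : 𝒪[L]ˣ) : 𝒪[L]) : L) = σ ((x : 𝒪[L]) : L) := rfl

end GaloisAction

noncomputable section

/-- A multiplicatively written commutative group `M` on which `G` acts by automorphisms, as a
`G`-module. The ring of coefficients is `ℤ`, lifted to the universe of `G`. -/
def mulModule (G M : Type u) [Group G] [CommGroup M] [MulDistribMulAction G M] :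
    Rep.{u} (ULift.{u} ℤ) G :=
  Rep.of (X := Additive M)
    { toFun g :=
        { toFun a := Additive.ofMul (g • a.toMul)
          map_add' a b := congrArg Additive.ofMul (smul_mul' g a.toMul b.toMul)
          map_smul' m a := congrArg Additive.ofMul (smul_zpow' g a.toMul m.down) }
      map_one' := LinearMap.ext fun a => congrArg Additive.ofMul (one_smul G a.toMul)
      map_mul' g h := LinearMap.ext fun a => congrArg Additive.ofMul (mul_smul g h a.toMul) }

theorem mulModule_ρ_apply {G M : Type u} [Group G] [CommGroup M] [MulDistribMulAction G M]
    (g : G) (a : Additive M) : (mulModule G M).ρ g a = Additive.ofMul (g • a.toMul) := rfl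

/-- The Herbrand quotient of `M` is defined when `H_T⁰(G, M)` and `H_T¹(G, M)` are finite. -/
def HerbrandDefined {R G : Type u} [CommRing R] [Group G] [Fintype G] (M : Rep.{u} R G) : Prop :=
  Finite (tateCohomology M 0) ∧ Finite (tateCohomology M 1)

/-- The Herbrand quotient `h(M) = |H_T⁰(G, M)| / |H_T¹(G, M)|` (meaningful when `G` is cyclic
and `HerbrandDefined M`). -/
def herbrandQuotient {R G : Type u} [CommRing R] [Group G] [Fintype G] (M : Rep.{u} R G) : ℚ :=
  (Nat.card (tateCohomology M 0) : ℚ) / (Nat.card (tateCohomology M 1) : ℚ)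

end

end LocalFieldCohomology

/-! ### Relative indices in commutative groups. -/

namespace Subgroup

/-! Let `σ` generate `G` and let `N` be the norm. Then `H_T⁰` and `H²` have order `[ker(σ-1) : im
N]`, and `H_T¹` has order `[ker N : im(σ-1)]`. The whole proof compares such indices.

Units: with `c` suitable and `Λ` the lattice spanned by the conjugates of an integral normal basis
generator, put `M i = π^(i+1+c) Λ`. Each `M i` is an induced module, so it has trivial cohomology.
Since `M i * M j ⊆ M (i+j+1)`, multiplication in `1 + M i` is addition modulo `M (i+1)`. Successive
approximation in the compact unit group makes `1 + M 0` cohomologically trivial. It has finite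
index, and finite modules have Herbrand quotient 1, so `h(U_L) = 1` (`units_relIndex_eq`). No
exponential is used, so the characteristic is irrelevant.

`Lˣ`: Hilbert 90 gives `ker N = im(σ-1)`. Together with `h(U_L) = 1`, an index computation yields
`[ker(σ-1) : im N] = [Lˣ : U_L · N Lˣ]` (`relIndex_range_ker_eq_index_sup`). This index is `n`,
because the norm multiplies valuations by `n`. -/

/-- If `V` meets `K` inside `H ≤ K`, the relative index of `H` in `K` can be computed modulo `V`. -/
theorem relIndex_map_mk_of_inf_le {U : Type*} [CommGroup U] {V H K : Subgroup U} (hHK : H ≤ K)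
    (hV : K ⊓ V ≤ H) :
    (H.map (QuotientGroup.mk' V)).relIndex (K.map (QuotientGroup.mk' V)) = H.relIndex K := by
  rw [relIndex_map_map, QuotientGroup.ker_mk']
  have h1 : K ⊔ V = K ⊔ (H ⊔ V) := by
    rw [← sup_assoc, sup_eq_left.mpr hHK]
  rw [h1, relIndex_sup_right, ← inf_relIndex_right, sup_inf_assoc_of_le _ hHK, inf_comm,
    sup_eq_left.mpr hV]

/-- Insert `H ⊔ (K ⊓ U)` between `H` and `K`. By the modular law, the upper quotient is that of `U ⊔
K` by `U ⊔ H`, the lower that of `K ⊓ U` by `H ⊓ U`. -/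
theorem relIndex_eq_relIndex_sup_mul_relIndex_inf {T : Type*} [CommGroup T] {H K : Subgroup T}
    (hHK : H ≤ K) (U : Subgroup T) :
    H.relIndex K = (U ⊔ H).relIndex (U ⊔ K) * (H ⊓ U).relIndex (K ⊓ U) := by
  have e : U ⊔ K = K ⊔ (U ⊔ H) := by
    rw [sup_comm U H, ← sup_assoc, sup_eq_left.mpr hHK, sup_comm]
  have h1 : (U ⊔ H).relIndex (U ⊔ K) = (H ⊔ K ⊓ U).relIndex K := by
    rw [e, relIndex_sup_right, ← inf_relIndex_right, sup_comm U, sup_inf_assoc_of_le _ hHK,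
      inf_comm U]
  have h2 : (H ⊓ U).relIndex (K ⊓ U) = H.relIndex (H ⊔ K ⊓ U) := by
    rw [relIndex_sup_left, ← inf_relIndex_right H (K ⊓ U), ← inf_assoc, inf_eq_left.mpr hHK]
  rw [h1, h2, mul_comm]
  exact (relIndex_mul_relIndex _ _ _ le_sup_left (sup_le hHK inf_le_left)).symm

end Subgroup

/-! ### Herbrand quotients of pairs of endomorphisms. -/

namespace MonoidHom

variable {U : Type*} [CommGroup U]

/-- The kernel and the range of an endomorphism of a finite group have complementary orders. -/
theorem card_ker_mul_card_range [Finite U] (f : U →* U) :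
    Nat.card f.ker * Nat.card f.range = Nat.card U := by
  rw [← Subgroup.index_ker, mul_comm]
  exact f.ker.index_mul_card

/-- The Herbrand quotient of two endomorphisms whose restriction to a subgroup of finite index is
exact equals `1`. -/
theorem relIndex_eq_relIndex_of_exact_on (f g : U →* U) (hfg : ∀ x, f (g x) = 1)
    (hgf : ∀ x, g (f x) = 1) (V : Subgroup U) [V.FiniteIndex] (hfV : V ≤ V.comap f)
    (hgV : V ≤ V.comap g) (hf : ∀ v ∈ V, f v = 1 → ∃ w ∈ V, g w = v)
    (hg : ∀ v ∈ V, g v = 1 → ∃ w ∈ V, f w = v) :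
    g.range.relIndex f.ker = f.range.relIndex g.ker ∧ f.range.relIndex g.ker ≠ 0 := by
  let π := QuotientGroup.mk' V
  have : Finite (U ⧸ V) := inferInstance
  have key : ∀ (f g : U →* U) (_ : ∀ x, f (g x) = 1) (_ : ∀ x, g (f x) = 1)
      (hfV : V ≤ V.comap f) (_ : ∀ v ∈ V, f v = 1 → ∃ w ∈ V, g w = v)
      (_ : ∀ v ∈ V, g v = 1 → ∃ w ∈ V, f w = v),
      Subgroup.map π f.ker = (QuotientGroup.map V V f hfV).ker ∧
      Subgroup.map π f.range = (QuotientGroup.map V V f hfV).range ∧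
      g.range ≤ f.ker ∧ f.ker ⊓ V ≤ g.range := by
    intro f g hfg hgf hfV hf hg
    refine ⟨?_, ?_, ?_, ?_⟩
    · ext q
      obtain ⟨u, rfl⟩ := QuotientGroup.mk'_surjective V q
      constructor
      · rintro ⟨y, hy, hyu⟩
        rw [← hyu, mem_ker]
        change ((f y : U) : U ⧸ V) = 1
        rw [SetLike.mem_coe, mem_ker] at hy
        rw [hy]; rfl
      · intro h
        have h' : f u ∈ V := (QuotientGroup.eq_one_iff _).mp h
        -- Exactness on `V` lifts the class: `f u` lies in `V` and is killed by `g`, so it equals `f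
        -- w` with `w ∈ V`, and `u / w` is a representative in `ker f`.
        obtain ⟨w, hw, hwu⟩ := hg _ h' (hgf u)
        refine ⟨u * w⁻¹, ?_, ?_⟩
        · simp [mem_ker, hwu]
        · have : π w⁻¹ = 1 := (QuotientGroup.eq_one_iff (N := V) w⁻¹).mpr (inv_mem hw)
          rw [map_mul, this, mul_one]
    · ext q
      constructor
      · rintro ⟨_, ⟨y, rfl⟩, rfl⟩
        exact ⟨(y : U ⧸ V), rfl⟩
      · rintro ⟨r, rfl⟩
        obtain ⟨y, rfl⟩ := QuotientGroup.mk'_surjective V r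
        exact ⟨f y, ⟨y, rfl⟩, rfl⟩
    · rintro _ ⟨y, rfl⟩
      exact hfg y
    · rintro u ⟨h1, h2⟩
      obtain ⟨w, -, hw⟩ := hf u h2 h1
      exact ⟨w, hw⟩
  obtain ⟨a1, a2, a3, a4⟩ := key f g hfg hgf hfV hf hg
  obtain ⟨b1, b2, b3, b4⟩ := key g f hgf hfg hgV hg hf
  have e1 := Subgroup.relIndex_map_mk_of_inf_le a3 a4
  have e2 := Subgroup.relIndex_map_mk_of_inf_le b3 b4
  have c1 := Subgroup.map_mono (f := π) a3
  have c2 := Subgroup.map_mono (f := π) b3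
  change (Subgroup.map π _).relIndex (Subgroup.map π _) = _ at e1 e2
  rw [← e1, ← e2]
  rw [a1, b2] at c1 ⊢
  rw [a2, b1] at c2 ⊢
  have h1 := Subgroup.relIndex_mul_relIndex ⊥ _ _ bot_le c1
  have h2 := Subgroup.relIndex_mul_relIndex ⊥ _ _ bot_le c2
  rw [Subgroup.relIndex_bot_left, Subgroup.relIndex_bot_left] at h1 h2
  -- On the finite quotient both products `|ker| * |range|` equal `|U ⧸ V|`. Substituting `h1` and
  -- `h2` leaves the two indices times the same factor.
  have h3 := card_ker_mul_card_range (QuotientGroup.map V V f hfV)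
  have h4 := card_ker_mul_card_range (QuotientGroup.map V V g hgV)
  rw [← h1, ← h4, ← h2] at h3
  refine ⟨?_, Subgroup.index_ne_zero_of_finite⟩
  have n1 : 0 < Nat.card (QuotientGroup.map V V f hfV).range := Nat.card_pos
  have n2 : 0 < Nat.card (QuotientGroup.map V V g hgV).range := Nat.card_pos
  refine Nat.eq_of_mul_eq_mul_left (Nat.mul_pos n1 n2) ?_
  linarith

/-- Let `f`, `g` be endomorphisms of `T` with `f ∘ g = 1` and `im f = ker g`. If the Herbrand
quotient of their restriction to a subgroup `U ⊇ ker g` is `1`, then `[ker f : im g]` equals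
`[T : U · im g]`. -/
theorem relIndex_range_ker_eq_index_sup {T U : Type*} [CommGroup T] [CommGroup U] (f g : T →* T)
    (f' g' : U →* U) (i : U →* T) (hi : Function.Injective i) (hf : ∀ u, i (f' u) = f (i u))
    (hg : ∀ u, i (g' u) = g (i u)) (hfg : ∀ x, f (g x) = 1) (hker : g.ker = f.range)
    (hgU : ∀ x, g x ∈ i.range → x ∈ i.range) (hkU : g.ker ≤ i.range)
    (hU : g'.range.relIndex f'.ker = f'.range.relIndex g'.ker) :
    g.range.relIndex f.ker = (i.range ⊔ g.range).index := by
  have hle : g.range ≤ f.ker := by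
    rintro _ ⟨y, rfl⟩; exact hfg y
  have kf : f'.ker.map i = f.ker ⊓ i.range := by
    ext x
    constructor
    · rintro ⟨u, hu, rfl⟩
      refine ⟨?_, u, rfl⟩
      have hu' : f' u = 1 := hu
      change f (i u) = 1
      rw [← hf, hu', map_one]
    · rintro ⟨h, u, rfl⟩
      refine ⟨u, hi ?_, rfl⟩
      rw [hf, map_one]; exact h
  have kg : g'.ker.map i = g.ker := by
    ext x
    constructor
    · rintro ⟨u, hu, rfl⟩
      have hu' : g' u = 1 := hu
      rw [mem_ker, ← hg, hu', map_one]
    · intro h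
      obtain ⟨u, rfl⟩ := hkU h
      refine ⟨u, hi ?_, rfl⟩
      rw [hg, map_one]; exact h
  have rg : g'.range.map i = g.range ⊓ i.range := by
    ext x
    constructor
    · rintro ⟨_, ⟨u, rfl⟩, rfl⟩
      exact ⟨⟨i u, (hg u).symm⟩, ⟨_, rfl⟩⟩
    · rintro ⟨⟨y, rfl⟩, h⟩
      obtain ⟨u, rfl⟩ := hgU y h
      exact ⟨g' u, ⟨u, rfl⟩, hg u⟩
  have rf : f'.range.map i = i.range.map f := by
    ext x
    constructor
    · rintro ⟨_, ⟨u, rfl⟩, rfl⟩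
      exact ⟨i u, ⟨u, rfl⟩, (hf u).symm⟩
    · rintro ⟨_, ⟨u, rfl⟩, rfl⟩
      exact ⟨f' u, ⟨u, rfl⟩, hf u⟩
  rw [← Subgroup.relIndex_map_map_of_injective _ _ hi,
    ← Subgroup.relIndex_map_map_of_injective _ _ hi, kf, kg, rg, rf, hker] at hU
  -- `[im f : f(U)] = [T : U · ker f]`
  have h1 : (i.range.map f).relIndex f.range = (i.range ⊔ f.ker).index := by
    rw [range_eq_map f, Subgroup.relIndex_map_map, top_sup_eq, Subgroup.relIndex_top_right]
  -- Split along `U`. By `hU` and `h1` the part inside `U` equals `[T : U · ker f]`, so the product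
  -- telescopes.
  have h2 : g.range.relIndex f.ker =
      (i.range ⊔ g.range).relIndex (i.range ⊔ f.ker) *
        (g.range ⊓ i.range).relIndex (f.ker ⊓ i.range) :=
    Subgroup.relIndex_eq_relIndex_sup_mul_relIndex_inf hle _
  rw [h2, hU, h1]
  exact Subgroup.relIndex_mul_index (sup_le_sup_left hle _)

end MonoidHom

/-! ### Tate cohomology of cyclic groups as relative indices. -/

section

open CategoryTheory

theorem CategoryTheory.ShortComplex.card_moduleCat_homology {R : Type*} [Ring R]
    (S : ShortComplex (ModuleCat R)) :
    Nat.card S.homology =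
      (LinearMap.range S.f.hom).toAddSubgroup.relIndex (LinearMap.ker S.g.hom).toAddSubgroup := by
  rw [Nat.card_congr S.moduleCatHomologyIso.toLinearEquiv.toEquiv]
  change (LinearMap.range S.moduleCatToCycles).toAddSubgroup.index = _
  congr 1
  ext x
  constructor
  · rintro ⟨y, rfl⟩
    exact ⟨y, rfl⟩
  · rintro ⟨y, hy⟩
    exact ⟨y, Subtype.ext hy⟩

theorem CategoryTheory.ShortComplex.card_moduleCat_homology_eq_relIndex {R : Type*} [Ring R]
    (S : ShortComplex (ModuleCat R)) {M : Type*} [CommGroup M] (e : Additive M ≃+ S.X₂)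
    (H K : Subgroup M) (hH : ∀ m, m ∈ H ↔ ∃ y, S.f.hom y = e (Additive.ofMul m))
    (hK : ∀ m, m ∈ K ↔ S.g.hom (e (Additive.ofMul m)) = 0) :
    Nat.card S.homology = H.relIndex K := by
  have h1 : (LinearMap.range S.f.hom).toAddSubgroup =
      (Subgroup.toAddSubgroup H).map e.toAddMonoidHom := by
    ext x
    obtain ⟨m, rfl⟩ := e.surjective x
    rw [show (e m) = e.toAddMonoidHom m from rfl,
      AddSubgroup.mem_map_iff_mem e.injective, Additive.mem_toAddSubgroup, hH]
    rfl
  have h2 : (LinearMap.ker S.g.hom).toAddSubgroup =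
      (Subgroup.toAddSubgroup K).map e.toAddMonoidHom := by
    ext x
    obtain ⟨m, rfl⟩ := e.surjective x
    rw [show (e m) = e.toAddMonoidHom m from rfl,
      AddSubgroup.mem_map_iff_mem e.injective, Additive.mem_toAddSubgroup, hK]
    rfl
  rw [S.card_moduleCat_homology, h1, h2, AddSubgroup.relIndex_map_map_of_injective _ _ e.injective,
    Subgroup.relIndex_toAddSubgroup]

namespace LocalFieldCohomology

section Group

variable {G M : Type u} [Group G] [CommGroup M] [MulDistribMulAction G M]

/-- The endomorphism `x ↦ g • x / x`. -/
def smulDivHom (M : Type u) [CommGroup M] [MulDistribMulAction G M] (g : G) : M →* M :=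
  MulDistribMulAction.toMonoidHom M g / MonoidHom.id M

theorem smulDivHom_apply (g : G) (x : M) : smulDivHom M g x = g • x / x := rfl

variable (G M) in
/-- The norm `x ↦ ∏ τ, τ • x`. -/
noncomputable def smulNormHom [Fintype G] : M →* M :=
  ∏ τ : G, MulDistribMulAction.toMonoidHom M τ

theorem smulNormHom_apply [Fintype G] (x : M) : smulNormHom G M x = ∏ τ : G, τ • x := by
  simp [smulNormHom]

theorem smul_smulNormHom [Fintype G] (g : G) (x : M) :
    g • smulNormHom G M x = smulNormHom G M x := by
  rw [smulNormHom_apply, Finset.smul_prod']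
  exact Fintype.prod_equiv (Equiv.mulLeft g) _ _ fun τ => by simp [mul_smul]

theorem smulNormHom_smul [Fintype G] (g : G) (x : M) :
    smulNormHom G M (g • x) = smulNormHom G M x := by
  rw [smulNormHom_apply, smulNormHom_apply]
  exact Fintype.prod_equiv (Equiv.mulRight g) _ _ fun τ => by simp [mul_smul]

theorem smulDivHom_smulNormHom [Fintype G] (g : G) (x : M) :
    smulDivHom M g (smulNormHom G M x) = 1 := by
  rw [smulDivHom_apply, smul_smulNormHom, div_self']

theorem smulNormHom_smulDivHom [Fintype G] (g : G) (x : M) :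
    smulNormHom G M (smulDivHom M g x) = 1 := by
  rw [smulDivHom_apply, map_div, smulNormHom_smul, div_self']

theorem mem_ker_smulDivHom {g : G} (hg : ∀ x, x ∈ Subgroup.zpowers g) {x : M} :
    x ∈ (smulDivHom M g).ker ↔ ∀ τ : G, τ • x = x := by
  rw [MonoidHom.mem_ker, smulDivHom_apply, div_eq_one]
  refine ⟨fun h τ => ?_, fun h => h g⟩
  have : Subgroup.zpowers g ≤ MulAction.stabilizer G x := by
    rw [Subgroup.zpowers_le]; exact h
  exact this (hg τ)

theorem norm_mulModule [Fintype G] (a : Additive M) :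
    (mulModule G M).ρ.norm a = Additive.ofMul (smulNormHom G M a.toMul) := by
  rw [smulNormHom_apply, ofMul_prod]
  exact LinearMap.sum_apply _ _ _

/-- Around degree 0 the Tate complex is the norm followed by `d₀₁`. The kernel of `d₀₁` is the
invariants, which for a cyclic group are detected by the generator. -/
theorem card_tateCohomology_zero [Fintype G] {g : G} (hg : ∀ x, x ∈ Subgroup.zpowers g) :
    Nat.card (tateCohomology (mulModule G M) 0) =
      (smulNormHom G M).range.relIndex (smulDivHom M g).ker := by
  let A := mulModule G M
  let S : ShortComplex (ModuleCat (ULift.{u} ℤ)) :=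
    ShortComplex.mk A.norm.toModuleCatHom (groupCohomology.d₀₁ A) (Rep.norm_comp_d_eq_zero A)
  let e : (tateComplex A).sc' (-1) 0 1 ≅ S :=
    ShortComplex.isoMk (groupHomology.chainsIso₀ A) (groupCohomology.cochainsIso₀ A)
      (groupCohomology.cochainsIso₁ A)
      (by
        change _ = Rep.tateNorm A ≫ _
        simp only [Rep.tateNorm, S, Category.assoc, Iso.inv_hom_id, Category.comp_id]
        rfl)
      (groupCohomology.comp_d₀₁_eq A)
  let e' : tateCohomology A 0 ≅ S.homology :=
    (tateComplex A).homologyIsoSc' (-1) 0 1 (by simp) (by simp) ≪≫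
      ShortComplex.homologyMapIso e
  rw [Nat.card_congr e'.toLinearEquiv.toEquiv]
  refine S.card_moduleCat_homology_eq_relIndex (AddEquiv.refl (Additive M)) _ _ (fun m => ?_)
    fun m => ?_
  · exact ⟨fun ⟨y, hy⟩ => ⟨Additive.ofMul y, (norm_mulModule _).trans hy⟩,
      fun ⟨y, hy⟩ => ⟨Additive.toMul (α := M) y, (norm_mulModule (M := M) y).symm.trans hy⟩⟩
  · rw [mem_ker_smulDivHom hg]
    exact ⟨fun h => funext fun τ => (sub_eq_zero (G := Additive M)).mpr (h τ),
      fun h τ => (sub_eq_zero (G := Additive M)).mp (congrFun h τ)⟩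

end Group

section CommGroup

variable {G M : Type u} [CommGroup G] [Fintype G] [CommGroup M] [MulDistribMulAction G M]

/-- The periodic complex of a cyclic group computes even degrees by the norm followed by `σ - 1`,
giving the same index as Tate degree 0. -/
theorem card_groupCohomology_two {g : G} (hg : ∀ x, x ∈ Subgroup.zpowers g) :
    Nat.card (groupCohomology (mulModule G M) 2) =
      (smulNormHom G M).range.relIndex (smulDivHom M g).ker := by
  rw [Nat.card_congr (Rep.FiniteCyclicGroup.groupCohomologyIsoEven (mulModule G M) g hg 2
    even_two).toLinearEquiv.toEquiv]
  refine ShortComplex.card_moduleCat_homology_eq_relIndex _ (AddEquiv.refl (Additive M)) _ _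
    (fun m => ?_) fun m => ?_
  · exact ⟨fun ⟨y, hy⟩ => ⟨Additive.ofMul y, (norm_mulModule _).trans hy⟩,
      fun ⟨y, hy⟩ => ⟨Additive.toMul (α := M) y, (norm_mulModule (M := M) y).symm.trans hy⟩⟩
  · rfl

theorem card_groupCohomology_one {g : G} (hg : ∀ x, x ∈ Subgroup.zpowers g) :
    Nat.card (groupCohomology (mulModule G M) 1) =
      (smulDivHom M g).range.relIndex (smulNormHom G M).ker := by
  rw [Nat.card_congr (Rep.FiniteCyclicGroup.groupCohomologyIsoOdd (mulModule G M) g hg 1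
    odd_one).toLinearEquiv.toEquiv]
  refine ShortComplex.card_moduleCat_homology_eq_relIndex _ (AddEquiv.refl (Additive M)) _ _
    (fun m => ?_) fun m => ?_
  · exact ⟨fun ⟨y, hy⟩ => ⟨Additive.ofMul y, hy⟩, fun ⟨y, hy⟩ => ⟨Additive.toMul (α := M) y, hy⟩⟩
  · rw [MonoidHom.mem_ker]
    exact ⟨fun h => (norm_mulModule _).trans h, fun h => (norm_mulModule _).symm.trans h⟩

theorem card_tateCohomology_one {g : G} (hg : ∀ x, x ∈ Subgroup.zpowers g) :
    Nat.card (tateCohomology (mulModule G M) 1) =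
      (smulDivHom M g).range.relIndex (smulNormHom G M).ker := by
  have e : tateCohomology (mulModule G M) 1 ≅ groupCohomology (mulModule G M) 1 :=
    (TateCohomology.isoGroupCohomology 1).app (mulModule G M)
  rw [Nat.card_congr e.toLinearEquiv.toEquiv, card_groupCohomology_one hg]

end CommGroup

end LocalFieldCohomology

end

/-! ### Lattices spanned by a normal basis. -/

namespace LocalFieldCohomology

section Lattice

variable {K L : Type*} [Field K] [Field L] [Algebra K L]

/-- The lattice `a · ⊕ B τ(x)` spanned by the conjugates of `x`, where `B` is the preimage in `K`
of the subring `O` of `L`. -/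
def conjLattice [Fintype Gal(L/K)] (O : Subring L) (x : L) (a : K) : AddSubgroup L where
  carrier := {y | ∃ b : Gal(L/K) → K, (∀ τ, algebraMap K L (b τ) ∈ O) ∧
    y = ∑ τ, (a * b τ) • τ x}
  add_mem' := by
    rintro _ _ ⟨b, hb, rfl⟩ ⟨b', hb', rfl⟩
    refine ⟨b + b', fun τ => ?_, ?_⟩
    · rw [Pi.add_apply, map_add]; exact add_mem (hb τ) (hb' τ)
    · simp [← Finset.sum_add_distrib, mul_add, add_smul]
  zero_mem' := ⟨0, fun τ => by simp, by simp⟩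
  neg_mem' := by
    rintro _ ⟨b, hb, rfl⟩
    refine ⟨-b, fun τ => ?_, ?_⟩
    · rw [Pi.neg_apply, map_neg]; exact neg_mem (hb τ)
    · simp

variable [Fintype Gal(L/K)] {O : Subring L} {x : L} {a : K}

theorem apply_mem_conjLattice (σ : Gal(L/K)) {y : L} (hy : y ∈ conjLattice O x a) :
    σ y ∈ conjLattice O x a := by
  obtain ⟨b, hb, rfl⟩ := hy
  refine ⟨fun τ => b (σ⁻¹ * τ), fun τ => hb _, ?_⟩
  rw [map_sum]
  exact Fintype.sum_equiv (Equiv.mulLeft σ) _ _ fun τ => by simp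

theorem smul_apply_mem_conjLattice {b : K} (hb : algebraMap K L b ∈ O) (τ : Gal(L/K)) :
    (a * b) • τ x ∈ conjLattice O x a := by
  classical
  refine ⟨Pi.single τ b, fun ρ => ?_, ?_⟩
  · by_cases h : ρ = τ
    · subst h; simpa using hb
    · simp [h]
  · rw [Finset.sum_eq_single τ]
    · simp
    · intro ρ _ h; simp [h]
    · simp

theorem conjLattice_le {a' c : K} (hc : algebraMap K L c ∈ O) (h : a = a' * c) :
    conjLattice O x a ≤ conjLattice O x a' := by
  rintro _ ⟨b, hb, rfl⟩
  refine ⟨fun τ => c * b τ, fun τ => ?_, ?_⟩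
  · rw [map_mul]; exact mul_mem hc (hb τ)
  · simp [h, mul_assoc]

theorem exists_eq_smul_of_mem_conjLattice (hx : ∀ τ : Gal(L/K), τ x ∈ O) {y : L}
    (hy : y ∈ conjLattice O x a) : ∃ z ∈ O, y = a • z := by
  obtain ⟨b, hb, rfl⟩ := hy
  refine ⟨∑ τ, b τ • τ x, sum_mem fun τ _ => ?_, ?_⟩
  · rw [Algebra.smul_def]; exact mul_mem (hb τ) (hx τ)
  · simp [Finset.smul_sum, mul_smul]

theorem smul_mem_conjLattice_of_mem {a' : K} {y : L} (hy : y ∈ conjLattice O x a) :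
    a' • y ∈ conjLattice O x (a' * a) := by
  obtain ⟨b, hb, rfl⟩ := hy
  exact ⟨b, hb, by simp [Finset.smul_sum, smul_smul, mul_assoc]⟩

variable (hli : LinearIndependent K fun τ : Gal(L/K) => τ x)

-- Invariance forces all coefficients to be equal, so `y` is the trace of the single term at the
-- identity.
include hli in
theorem exists_trace_eq_of_fixed {y : L} (hy : y ∈ conjLattice O x a)
    (hfix : ∀ σ : Gal(L/K), σ y = y) : ∃ z ∈ conjLattice O x a, ∑ τ : Gal(L/K), τ z = y := by
  obtain ⟨b, hb, rfl⟩ := hy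
  have h : ∀ τ, a * b τ = a * b 1 := by
    intro τ
    have h1 : ∑ ρ, (a * b (τ⁻¹ * ρ)) • ρ x = ∑ ρ, (a * b ρ) • ρ x := by
      rw [← hfix τ, map_sum]
      exact (Fintype.sum_equiv (Equiv.mulLeft τ) _ _ fun ρ => by simp).symm
    have h2 := Fintype.linearIndependent_iff.mp hli
      (fun ρ => a * b (τ⁻¹ * ρ) - a * b ρ) (by simp [sub_smul, h1]) τ
    simp only [inv_mul_cancel] at h2
    exact (sub_eq_zero.mp h2).symm
  refine ⟨(a * b 1) • (1 : Gal(L/K)) x, smul_apply_mem_conjLattice (hb 1) 1, ?_⟩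
  exact Finset.sum_congr rfl fun τ _ => by simp [h τ]

-- Trace zero forces the coefficients to sum to zero, so `y = ∑ a b_τ (τ x - x)`. Writing `τ = σ^k`,
-- the telescoping sum over `j < k` of `σ^j x` shows each `τ x - x` to be in the image of `σ - 1`.
include hli in
theorem exists_sub_eq_of_trace_eq_zero {σ : Gal(L/K)} (hσ : ∀ τ, τ ∈ Subgroup.zpowers σ) {y : L}
    (hy : y ∈ conjLattice O x a) (htr : ∑ τ : Gal(L/K), τ y = 0) :
    ∃ z ∈ conjLattice O x a, σ z - z = y := by
  obtain ⟨b, hb, rfl⟩ := hy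
  have hsum : ∑ τ, a * b τ = 0 := by
    have h1 : ∑ ρ : Gal(L/K), (∑ τ, a * b τ) • ρ x = 0 := by
      rw [← htr]
      simp_rw [map_sum, Finset.sum_smul]
      rw [Finset.sum_comm]
      conv_rhs => rw [Finset.sum_comm]
      refine Finset.sum_congr rfl fun τ _ => ?_
      exact Fintype.sum_equiv (Equiv.mulRight τ⁻¹) _ _ fun ρ => by simp
    exact Fintype.linearIndependent_iff.mp hli _ h1 1
  have hk : ∀ τ : Gal(L/K), ∃ k : ℕ, σ ^ k = τ := fun τ => by
    have := hσ τ
    rwa [← mem_powers_iff_mem_zpowers] at this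
  choose k hk using hk
  refine ⟨∑ τ, ∑ j ∈ Finset.range (k τ), (a * b τ) • (σ ^ j) x, sum_mem fun τ _ =>
    sum_mem fun j _ => smul_apply_mem_conjLattice (hb τ) _, ?_⟩
  have : ∀ τ, σ (∑ j ∈ Finset.range (k τ), (a * b τ) • (σ ^ j) x) -
      ∑ j ∈ Finset.range (k τ), (a * b τ) • (σ ^ j) x = (a * b τ) • τ x - (a * b τ) • x := by
    intro τ
    rw [map_sum, ← Finset.sum_sub_distrib]
    have e := Finset.sum_range_sub (fun j => (a * b τ) • (σ ^ j) x) (k τ)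
    rw [hk τ, pow_zero, AlgEquiv.one_apply] at e
    rw [← e]
    exact Finset.sum_congr rfl fun j _ => by rw [map_smul, pow_succ', AlgEquiv.mul_apply]
  rw [map_sum, ← Finset.sum_sub_distrib]
  simp_rw [this]
  rw [Finset.sum_sub_distrib, ← Finset.sum_smul, hsum, zero_smul, sub_zero]

end Lattice

/-! ### A filtration by cohomologically trivial lattices. -/

section Filtration

variable {K L : Type*} [Field K] [Field L] [Algebra K L] [FiniteDimensional K L] [IsGalois K L]
  {O : Subring L} (hO : ∀ (τ : Gal(L/K)) (y : L), y ∈ O → τ y ∈ O) {π : K}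
  (hπ0 : π ≠ 0) (hπO : algebraMap K L π ∈ O) (hπ : ∀ y : L, ∃ n : ℕ, π ^ n • y ∈ O)

include hO hπO hπ in
/-- A lattice spanned by the conjugates of a normal basis element contains a multiple of `O`. -/
theorem exists_smul_mem_conjLattice {x : L}
    (hli : LinearIndependent K fun τ : Gal(L/K) => τ x) :
    ∃ n : ℕ, ∀ y ∈ O, π ^ n • y ∈ conjLattice O x (1 : K) := by
  let e : Module.Basis Gal(L/K) K L := basisOfLinearIndependentOfCardEqFinrank hli
    (Fintype.card_eq_nat_card.trans <| IsGalois.card_aut_eq_finrank K L)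
  have he : ∀ τ, e τ = τ x := fun τ => by
    simp [e, coe_basisOfLinearIndependentOfCardEqFinrank]
  -- Coordinates are trace forms `y ↦ Tr (d y)`. Once a power of `π` clears the denominators of the
  -- `d τ`, they are integral on `O`, a trace being a sum of conjugates.
  have hd : ∀ τ, ∃ d : L, ∀ y, e.repr y τ = Algebra.trace K L (d * y) := by
    intro τ
    let b := (Algebra.traceForm K L).toDual (traceForm_nondegenerate K L)
    refine ⟨b.symm (e.coord τ), fun y => ?_⟩
    have : b (b.symm (e.coord τ)) y = e.coord τ y := by rw [b.apply_symm_apply]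
    exact this.symm
  choose d hd using hd
  choose m hm using fun τ => hπ (d τ)
  have hpow : ∀ k : ℕ, algebraMap K L (π ^ k) ∈ O := fun k => by
    rw [map_pow]; exact pow_mem hπO k
  refine ⟨∑ τ, m τ, fun y hy => ⟨fun τ => π ^ (∑ τ, m τ) * e.repr y τ, fun τ => ?_, ?_⟩⟩
  · have h1 : π ^ (∑ τ, m τ) • d τ ∈ O := by
      obtain ⟨k, hk⟩ := Nat.exists_eq_add_of_le
        (Finset.single_le_sum (f := m) (fun _ _ => Nat.zero_le _) (Finset.mem_univ τ))
      rw [hk, add_comm, pow_add, mul_smul, Algebra.smul_def]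
      exact mul_mem (hpow k) (hm τ)
    change algebraMap K L (π ^ _ * e.repr y τ) ∈ O
    rw [hd τ y, ← smul_eq_mul, ← map_smul, ← smul_mul_assoc,
      trace_eq_sum_automorphisms]
    exact sum_mem fun ρ _ => hO ρ _ (mul_mem h1 hy)
  · conv_lhs => rw [← e.sum_repr y]
    simp [Finset.smul_sum, smul_smul, he]

variable (O π) in
/-- A filtration of a neighbourhood of `0` in `L` by lattices which are trivial for the Tate
cohomology of the group generated by `σ`. -/
structure TrivialFiltration (σ : Gal(L/K)) where
  /-- The lattices. -/
  M : ℕ → AddSubgroup L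
  /-- The exponent of a multiple of `O` in the first lattice. -/
  c : ℕ
  apply_mem : ∀ i (τ : Gal(L/K)), ∀ y ∈ M i, τ y ∈ M i
  exists_trace_eq : ∀ i, ∀ y ∈ M i, (∀ τ : Gal(L/K), τ y = y) →
    ∃ z ∈ M i, ∑ τ : Gal(L/K), τ z = y
  exists_sub_eq : ∀ i, ∀ y ∈ M i, ∑ τ : Gal(L/K), τ y = 0 → ∃ z ∈ M i, σ z - z = y
  succ_le : ∀ i, M (i + 1) ≤ M i
  -- The extra `1` makes products of two elements of `M i` negligible modulo `M (i + 1)`, even for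
  -- `i = 0`.
  mul_mem : ∀ i j, ∀ y ∈ M i, ∀ z ∈ M j, y * z ∈ M (i + j + 1)
  exists_eq_smul : ∀ i, ∀ y ∈ M i, ∃ z ∈ O, y = π ^ (i + 1) • z
  smul_mem : ∀ i, ∀ y ∈ O, π ^ (i + c) • y ∈ M i

include hO hπ0 hπO hπ in
theorem nonempty_trivialFiltration {σ : Gal(L/K)} (hσ : ∀ τ, τ ∈ Subgroup.zpowers σ) :
    Nonempty (TrivialFiltration O π σ) := by
  obtain ⟨x, hxO, hli⟩ : ∃ x ∈ O, LinearIndependent K fun τ : Gal(L/K) => τ x := by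
    let x₀ := IsGalois.normalBasis K L 1
    obtain ⟨n, hn⟩ := hπ x₀
    refine ⟨π ^ n • x₀, hn, ?_⟩
    have h : LinearIndependent K fun τ : Gal(L/K) => τ x₀ := by
      have := (IsGalois.normalBasis K L).linearIndependent
      convert this using 2 with τ
      exact (IsGalois.normalBasis_apply τ).symm
    convert h.units_smul (fun _ => (Units.mk0 π hπ0) ^ n) using 2 with τ
    simp [Units.smul_def]
  obtain ⟨c, hc⟩ := exists_smul_mem_conjLattice hO hπO hπ hli
  have hpow : ∀ k : ℕ, algebraMap K L (π ^ k) ∈ O := fun k => by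
    rw [map_pow]; exact pow_mem hπO k
  have hxτ : ∀ τ : Gal(L/K), τ x ∈ O := fun τ => hO τ x hxO
  -- Here `π^c O ⊆ Λ ⊆ O`. Hence `M i * M j ⊆ π^(i+j+2+2c) O ⊆ M (i+j+1)`, and `π^(i+1+2c) O ⊆ M i`,
  -- which explains the exponent `1 + c + c`.
  refine ⟨⟨fun i => conjLattice O x (π ^ (i + 1 + c)), 1 + c + c,
    fun i τ y hy => apply_mem_conjLattice τ hy,
    fun i y hy h => exists_trace_eq_of_fixed hli hy h,
    fun i y hy h => exists_sub_eq_of_trace_eq_zero hli hσ hy h,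
    fun i => conjLattice_le hπO (by ring), fun i j y hy z hz => ?_, fun i y hy => ?_,
    fun i y hy => ?_⟩⟩
  · obtain ⟨y', hy', rfl⟩ := exists_eq_smul_of_mem_conjLattice hxτ hy
    obtain ⟨z', hz', rfl⟩ := exists_eq_smul_of_mem_conjLattice hxτ hz
    have := smul_mem_conjLattice_of_mem (a' := π ^ (i + j + 1 + 1 + c)) (hc _ (mul_mem hy' hz'))
    rw [mul_one] at this
    convert this using 1
    rw [smul_mul_smul_comm, smul_smul]
    ring_nf
  · obtain ⟨y', hy', rfl⟩ := exists_eq_smul_of_mem_conjLattice hxτ hy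
    refine ⟨π ^ c • y', ?_, ?_⟩
    · rw [Algebra.smul_def]; exact mul_mem (hpow c) hy'
    · rw [smul_smul]; ring_nf
  · have := smul_mem_conjLattice_of_mem (a' := π ^ (i + 1 + c)) (hc _ hy)
    rw [mul_one] at this
    convert this using 1
    rw [smul_smul]
    ring_nf

end Filtration

/-- Successive approximation in a compact group with a separated filtration by open subgroups. -/
theorem exists_apply_eq_of_approx {U : Type*} [CommGroup U] [TopologicalSpace U]
    [IsTopologicalGroup U] [CompactSpace U] (V : ℕ → Subgroup U) (hanti : ∀ i, V (i + 1) ≤ V i)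
    (hopen : ∀ i, IsOpen (V i : Set U)) (hinf : ∀ u, (∀ i, u ∈ V i) → u = 1) (f g : U →* U)
    (hg : Continuous g) (hfg : ∀ x, f (g x) = 1)
    (step : ∀ i, ∀ u ∈ V i, f u = 1 → ∃ w ∈ V i, u / g w ∈ V (i + 1)) {u : U} (hu : u ∈ V 0)
    (hfu : f u = 1) : ∃ w ∈ V 0, g w = u := by
  have hle : ∀ i, V i ≤ V 0 := fun i => antitone_nat_of_succ_le hanti (Nat.zero_le i)
  have h : ∀ i, ∃ w ∈ V 0, u / g w ∈ V i := by
    intro i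
    induction i with
    | zero => exact ⟨1, one_mem _, by simpa using hu⟩
    | succ i ih =>
      obtain ⟨w, hw, hwi⟩ := ih
      obtain ⟨w', hw', h'⟩ := step i _ hwi (by rw [map_div, hfu, hfg, div_one])
      exact ⟨w * w', mul_mem hw (hle i hw'), by rwa [map_mul, ← div_div]⟩
  -- The approximate solutions form nested nonempty compact sets; separatedness makes a common point
  -- an exact solution.
  let S : ℕ → Set U := fun i => {w | w ∈ V 0 ∧ u / g w ∈ V i}
  have hS : ∀ i, IsClosed (S i) := fun i =>
    ((V 0).isClosed_of_isOpen (hopen 0)).inter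
      (((V i).isClosed_of_isOpen (hopen i)).preimage (continuous_const.div' hg))
  obtain ⟨w, hw⟩ := (hS 0).isCompact.nonempty_iInter_of_sequence_nonempty_isCompact_isClosed S
    (fun i w hw => ⟨hw.1, hanti i hw.2⟩) h hS
  rw [Set.mem_iInter] at hw
  exact ⟨w, (hw 0).1, (div_eq_one.mp (hinf _ fun i => (hw i).2)).symm⟩

/-! ### Galois invariance of the valuation. -/

section Valuation

variable {K L : Type*} [Field K] [Field L] [ValuativeRel L] [TopologicalSpace L]
  [IsNonarchimedeanLocalField L] [Algebra K L]

theorem smul_mem_maximalIdeal (τ : Gal(L/K)) {x : 𝒪[L]} (hx : x ∈ 𝓂[L]) : τ • x ∈ 𝓂[L] := by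
  rw [IsLocalRing.mem_maximalIdeal, mem_nonunits_iff] at hx ⊢
  intro h
  refine hx ?_
  have := h.map (MulSemiringAction.toRingHom Gal(L/K) 𝒪[L] τ⁻¹)
  simpa using this

/-- An automorphism preserves the maximal ideal, so it sends a uniformizer `ϖ` to an integral
multiple of `ϖ`. Hence it sends `x` to an integral multiple of `x`. -/
theorem valuation_apply_le (τ : Gal(L/K)) (x : 𝒪[L]) :
    valuation L (τ (x : L)) ≤ valuation L (x : L) := by
  by_cases hx : x = 0
  · subst hx; simp
  obtain ⟨ϖ, hϖ⟩ := IsDiscreteValuationRing.exists_irreducible 𝒪[L]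
  obtain ⟨n, u, rfl⟩ := IsDiscreteValuationRing.eq_unit_mul_pow_irreducible hx hϖ
  have h1 : τ • ϖ ∈ 𝓂[L] :=
    smul_mem_maximalIdeal τ ((IsLocalRing.mem_maximalIdeal _).mpr hϖ.not_isUnit)
  rw [hϖ.maximalIdeal_eq, Ideal.mem_span_singleton] at h1
  obtain ⟨z, hz⟩ := h1
  have h2 : τ • ((u : 𝒪[L]) * ϖ ^ n) = ((u : 𝒪[L]) * ϖ ^ n) *
      (((u⁻¹ : 𝒪[L]ˣ) : 𝒪[L]) * (τ • (u : 𝒪[L])) * z ^ n) := by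
    rw [smul_mul', smul_pow', hz]
    calc _ = ((u : 𝒪[L]) * ((u⁻¹ : 𝒪[L]ˣ) : 𝒪[L])) * (τ • (u : 𝒪[L]) * (ϖ * z) ^ n) := by
          rw [Units.mul_inv, one_mul]
      _ = _ := by ring
  rw [← coe_smul_integer, h2, Subring.coe_mul, map_mul]
  exact mul_le_of_le_one_right' (Subtype.prop (p := fun x : L => x ∈ 𝒪[L]) _)

/-- The valuation of a local field is invariant under automorphisms. -/
theorem valuation_apply (τ : Gal(L/K)) (x : L) : valuation L (τ x) = valuation L x := by
  have key : ∀ (τ : Gal(L/K)) (x : 𝒪[L]), valuation L (τ (x : L)) = valuation L (x : L) := by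
    refine fun τ x => le_antisymm (valuation_apply_le τ x) ?_
    have := valuation_apply_le τ⁻¹ (τ • x)
    rwa [coe_smul_integer, ← AlgEquiv.mul_apply, inv_mul_cancel, AlgEquiv.one_apply] at this
  rcases le_total (valuation L x) 1 with h | h
  · exact key τ ⟨x, h⟩
  · have h' : valuation L x⁻¹ ≤ 1 := by
      rw [map_inv₀]; exact inv_le_one_of_one_le₀ h
    have := key τ ⟨x⁻¹, h'⟩
    simpa using this

theorem continuous_galois_apply (τ : Gal(L/K)) : Continuous fun x : L => τ x := by
  refine continuous_of_continuousAt_zero (τ : L →+* L).toAddMonoidHom ?_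
  rw [ContinuousAt]
  change Filter.Tendsto (fun x : L => τ x) (nhds 0) (nhds (τ 0))
  rw [map_zero, (IsValuativeTopology.hasBasis_nhds_zero' L).tendsto_iff
    (IsValuativeTopology.hasBasis_nhds_zero' L)]
  exact fun γ hγ => ⟨γ, hγ, fun x hx => by simpa [valuation_apply] using hx⟩

theorem continuous_smul_units (τ : Gal(L/K)) : Continuous fun x : 𝒪[L]ˣ => τ • x := by
  have h : Continuous fun x : 𝒪[L] => τ • x :=
    Continuous.subtype_mk ((continuous_galois_apply τ).comp continuous_subtype_val) _
  exact Continuous.units_map (MulDistribMulAction.toMonoidHom 𝒪[L] τ) h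

end Valuation

/-! ### The induced filtration of the unit group. -/

section Units

variable {K L : Type*} [Field K] [Field L] [ValuativeRel L] [TopologicalSpace L]
  [IsNonarchimedeanLocalField L] [Algebra K L] [FiniteDimensional K L]
  {π : K} {σ : Gal(L/K)}

/-- The unit `1 + z`. -/
def oneAddUnit (z : L) (hz : valuation L z < 1) : 𝒪[L]ˣ where
  val := ⟨1 + z, by
    rw [Valuation.mem_integer_iff, Valuation.map_one_add_of_lt _ hz]⟩
  inv := ⟨(1 + z)⁻¹, by
    rw [Valuation.mem_integer_iff, map_inv₀, Valuation.map_one_add_of_lt _ hz, inv_one]⟩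
  val_inv := Subtype.ext (mul_inv_cancel₀ fun h => by
    have := Valuation.map_one_add_of_lt (valuation L) hz
    rw [show 1 + z = 0 from h, map_zero] at this
    exact zero_ne_one this)
  inv_val := Subtype.ext (inv_mul_cancel₀ fun h => by
    have := Valuation.map_one_add_of_lt (valuation L) hz
    rw [show 1 + z = 0 from h, map_zero] at this
    exact zero_ne_one this)

namespace TrivialFiltration

variable (F : TrivialFiltration 𝒪[L] π σ)

omit [TopologicalSpace L] [IsNonarchimedeanLocalField L]

theorem le_of_le {i j : ℕ} (h : i ≤ j) : F.M j ≤ F.M i := antitone_nat_of_succ_le F.succ_le h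

theorem mul_mem' {i j k : ℕ} (h : k ≤ i + j + 1) {y z : L} (hy : y ∈ F.M i) (hz : z ∈ F.M j) :
    y * z ∈ F.M k :=
  F.le_of_le h (F.mul_mem i j y hy z hz)

/-- To first order the norm on `1 + M i` is the trace on `M i`: the cross terms contain two factors
from `M i`. -/
theorem prod_one_add_sub_mem {ι : Type*} (s : Finset ι) (z : ι → L) {i : ℕ}
    (hz : ∀ j, z j ∈ F.M i) : ∏ j ∈ s, (1 + z j) - (1 + ∑ j ∈ s, z j) ∈ F.M (i + 1) := by
  classical
  induction s using Finset.induction_on with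
  | empty => simp
  | insert a s ha ih =>
    rw [Finset.prod_insert ha, Finset.sum_insert ha]
    set r := ∏ j ∈ s, (1 + z j) - (1 + ∑ j ∈ s, z j) with hr
    have h1 : ∏ j ∈ s, (1 + z j) = r + (1 + ∑ j ∈ s, z j) := by rw [hr]; ring
    have h2 : (1 + z a) * ∏ j ∈ s, (1 + z j) - (1 + (z a + ∑ j ∈ s, z j)) =
        r + z a * r + z a * ∑ j ∈ s, z j := by rw [h1]; ring
    rw [h2]
    exact add_mem (add_mem ih (F.mul_mem' (by omega) (hz a) ih))
      (F.mul_mem' (by omega) (hz a) (sum_mem fun j _ => hz j))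

theorem valuation_le {i : ℕ} {y : L} (hy : y ∈ F.M i) :
    valuation L y ≤ valuation L (algebraMap K L π) ^ (i + 1) := by
  obtain ⟨z, hz, rfl⟩ := F.exists_eq_smul i y hy
  rw [Algebra.smul_def, map_mul, map_pow, map_pow]
  exact mul_le_of_le_one_right' hz

theorem mem_of_valuation_le (hπ0 : π ≠ 0) {i : ℕ} {y : L}
    (hy : valuation L y ≤ valuation L (algebraMap K L π) ^ (i + F.c)) : y ∈ F.M i := by
  have h0 : valuation L (algebraMap K L π) ≠ 0 := by simpa using hπ0
  have := F.smul_mem i ((π ^ (i + F.c))⁻¹ • y) ?_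
  · rwa [smul_inv_smul₀ (pow_ne_zero _ hπ0)] at this
  · rw [Valuation.mem_integer_iff, Algebra.smul_def, map_mul, map_inv₀, map_inv₀, map_pow, map_pow,
      inv_mul_le_iff₀ (zero_lt_iff.mpr (pow_ne_zero _ h0)), mul_one]
    exact hy

theorem pow_succ_mem {i : ℕ} {y : L} (hy : y ∈ F.M i) (n : ℕ) : y ^ (n + 1) ∈ F.M i := by
  induction n with
  | zero => simpa using hy
  | succ n ih => rw [pow_succ]; exact F.mul_mem' (by omega) ih hy

/-- The subgroup of units congruent to `1` modulo a step of the filtration. -/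
def unitSubgroup (hπ0 : π ≠ 0) (i : ℕ) : Subgroup 𝒪[L]ˣ where
  carrier := {u | ((u : 𝒪[L]) : L) - 1 ∈ F.M i}
  one_mem' := by simp
  mul_mem' := by
    intro u v hu hv
    have : (((u * v : 𝒪[L]ˣ) : 𝒪[L]) : L) - 1 = (((u : 𝒪[L]) : L) - 1) * (((v : 𝒪[L]) : L) - 1) +
      (((u : 𝒪[L]) : L) - 1) + (((v : 𝒪[L]) : L) - 1) := by
      rw [Units.val_mul, Subring.coe_mul]; ring
    rw [Set.mem_ofPred_eq, this]
    exact add_mem (add_mem (F.mul_mem' (by omega) hu hv) hu) hv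
  inv_mem' := by
    intro u hu
    rw [Set.mem_ofPred_eq] at hu ⊢
    set y : L := ((u : 𝒪[L]) : L) - 1 with hy
    set v : L := (((u⁻¹ : 𝒪[L]ˣ) : 𝒪[L]) : L) with hv
    have hyv : (1 + y) * v = 1 := by
      rw [hy, hv, add_sub_cancel, ← Subring.coe_mul, Units.mul_inv, Subring.coe_one]
    -- A truncated geometric series for the inverse, with explicit remainder. The truncation `n = i
    -- + c` makes the remainder small enough to lie in `M i`.
    have hex : ∀ n : ℕ, ∃ m ∈ F.M i, v - 1 = m + (-y) ^ (n + 1) * v := by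
      intro n
      induction n with
      | zero => exact ⟨0, zero_mem _, by linear_combination hyv⟩
      | succ n ih =>
        obtain ⟨m, hm, h⟩ := ih
        refine ⟨m + (-y) ^ (n + 1), add_mem hm (F.pow_succ_mem (neg_mem hu) n), ?_⟩
        rw [h]
        linear_combination (-y) ^ (n + 1) * hyv
    obtain ⟨m, hm, h⟩ := hex (i + F.c)
    rw [h]
    refine add_mem hm (F.mem_of_valuation_le hπ0 ?_)
    have hy1 : valuation L y ≤ valuation L (algebraMap K L π) := by
      simpa using F.valuation_le (F.le_of_le (Nat.zero_le i) hu)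
    have hy2 : valuation L y ≤ 1 := sub_mem (Subtype.prop (u : 𝒪[L])) (one_mem _)
    have hv1 : valuation L v ≤ 1 := Subtype.prop ((u⁻¹ : 𝒪[L]ˣ) : 𝒪[L])
    rw [map_mul, map_pow, Valuation.map_neg, pow_succ, mul_assoc]
    exact (mul_le_of_le_one_right' (mul_le_one' hy2 hv1)).trans
      (pow_le_pow_left₀ zero_le hy1 _)

variable (hπ0 : π ≠ 0)

theorem mem_unitSubgroup {i : ℕ} {u : 𝒪[L]ˣ} :
    u ∈ F.unitSubgroup hπ0 i ↔ ((u : 𝒪[L]) : L) - 1 ∈ F.M i := Iff.rfl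

theorem unitSubgroup_succ_le (i : ℕ) : F.unitSubgroup hπ0 (i + 1) ≤ F.unitSubgroup hπ0 i :=
  fun _ hu => F.succ_le i hu

theorem unitSubgroup_le_zero (i : ℕ) : F.unitSubgroup hπ0 i ≤ F.unitSubgroup hπ0 0 :=
  antitone_nat_of_succ_le (F.unitSubgroup_succ_le hπ0) (Nat.zero_le i)

/-- `M i` need not be stable under multiplication by units. Writing `v⁻¹ = 1 + (v⁻¹ - 1)` with `v⁻¹
- 1 ∈ M 0` reduces the claim to products of filtration elements. -/
theorem div_mem_unitSubgroup {i : ℕ} {u v : 𝒪[L]ˣ} (hv : v ∈ F.unitSubgroup hπ0 0)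
    (h : ((u : 𝒪[L]) : L) - ((v : 𝒪[L]) : L) ∈ F.M i) : u / v ∈ F.unitSubgroup hπ0 i := by
  have hv' := (F.mem_unitSubgroup hπ0).mp (inv_mem hv)
  rw [mem_unitSubgroup]
  have hvv : ((v : 𝒪[L]) : L) * (((v⁻¹ : 𝒪[L]ˣ) : 𝒪[L]) : L) = 1 := by
    rw [← Subring.coe_mul, Units.mul_inv, Subring.coe_one]
  have : (((u / v : 𝒪[L]ˣ) : 𝒪[L]) : L) - 1 =
      (((u : 𝒪[L]) : L) - ((v : 𝒪[L]) : L)) * ((((v⁻¹ : 𝒪[L]ˣ) : 𝒪[L]) : L) - 1) +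
        (((u : 𝒪[L]) : L) - ((v : 𝒪[L]) : L)) := by
    rw [div_eq_mul_inv, Units.val_mul, Subring.coe_mul]
    linear_combination hvv
  rw [this]
  exact add_mem (F.mul_mem' (by omega) h hv') h

end TrivialFiltration

namespace TrivialFiltration

variable (F : TrivialFiltration 𝒪[L] π σ) (hπ0 : π ≠ 0)

theorem smul_mem_unitSubgroup {i : ℕ} {u : 𝒪[L]ˣ} (τ : Gal(L/K))
    (hu : u ∈ F.unitSubgroup hπ0 i) : τ • u ∈ F.unitSubgroup hπ0 i := by
  rw [mem_unitSubgroup] at hu ⊢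
  rw [coe_smul_units]
  simpa using F.apply_mem i τ _ hu

theorem smulDivHom_mem_unitSubgroup {i : ℕ} {u : 𝒪[L]ˣ} (τ : Gal(L/K))
    (hu : u ∈ F.unitSubgroup hπ0 i) : smulDivHom 𝒪[L]ˣ τ u ∈ F.unitSubgroup hπ0 i :=
  div_mem (F.smul_mem_unitSubgroup hπ0 τ hu) hu

theorem smulNormHom_mem_unitSubgroup {i : ℕ} {u : 𝒪[L]ˣ} (hu : u ∈ F.unitSubgroup hπ0 i) :
    smulNormHom Gal(L/K) 𝒪[L]ˣ u ∈ F.unitSubgroup hπ0 i := by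
  rw [smulNormHom_apply]
  exact prod_mem fun τ _ => F.smul_mem_unitSubgroup hπ0 τ hu

omit [FiniteDimensional K L] in
theorem coe_smulNormHom_units [Fintype Gal(L/K)] (u : 𝒪[L]ˣ) :
    ((smulNormHom Gal(L/K) 𝒪[L]ˣ u : 𝒪[L]) : L) = ∏ τ : Gal(L/K), τ ((u : 𝒪[L]) : L) := by
  rw [smulNormHom_apply]
  push_cast
  rfl

theorem norm_sub_mem {i : ℕ} {u : 𝒪[L]ˣ} (hu : u ∈ F.unitSubgroup hπ0 i) :
    ((smulNormHom Gal(L/K) 𝒪[L]ˣ u : 𝒪[L]) : L) -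
      (1 + ∑ τ : Gal(L/K), τ (((u : 𝒪[L]) : L) - 1)) ∈ F.M (i + 1) := by
  rw [coe_smulNormHom_units]
  have := F.prod_one_add_sub_mem Finset.univ
    (fun τ : Gal(L/K) => τ (((u : 𝒪[L]) : L) - 1)) (fun τ => F.apply_mem i τ _ hu)
  simpa using this

theorem isOpen_unitSubgroup (i : ℕ) : IsOpen (F.unitSubgroup hπ0 i : Set 𝒪[L]ˣ) := by
  have h0 : valuation L (algebraMap K L π) ≠ 0 := by simpa using hπ0
  refine Subgroup.isOpen_of_mem_nhds (g := 1) _ ?_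
  have hc : Continuous fun u : 𝒪[L]ˣ => ((u : 𝒪[L]) : L) - 1 :=
    (continuous_subtype_val.comp Units.continuous_val).sub continuous_const
  have h1 : Filter.Tendsto (fun u : 𝒪[L]ˣ => ((u : 𝒪[L]) : L) - 1) (nhds 1) (nhds 0) := by
    have := hc.tendsto 1
    simpa using this
  have h2 : {x : L | valuation L x < valuation L (algebraMap K L π) ^ (i + F.c)} ∈ nhds (0 : L) :=
    (IsValuativeTopology.hasBasis_nhds_zero' L).mem_of_mem (pow_ne_zero _ h0)
  exact Filter.mem_of_superset (h1 h2) fun u hu => F.mem_of_valuation_le hπ0 (le_of_lt hu)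

variable (hπ1 : valuation L (algebraMap K L π) < 1)

omit [TopologicalSpace L] [IsNonarchimedeanLocalField L] in
include hπ1 in
theorem exists_mem_unitSubgroup {i : ℕ} {z : L} (hz : z ∈ F.M i) :
    ∃ w ∈ F.unitSubgroup hπ0 i, ((w : 𝒪[L]) : L) = 1 + z := by
  have h : valuation L z < 1 :=
    (F.valuation_le hz).trans_lt (pow_lt_one₀ zero_le hπ1 (Nat.succ_ne_zero i))
  refine ⟨oneAddUnit z h, ?_, rfl⟩
  rw [mem_unitSubgroup]
  simpa [oneAddUnit] using hz

include hπ1 in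
theorem eq_one_of_forall_mem (u : 𝒪[L]ˣ) (hu : ∀ i, u ∈ F.unitSubgroup hπ0 i) : u = 1 := by
  have h0 : 0 < valuation L (algebraMap K L π) := zero_lt_iff.mpr (by simpa using hπ0)
  by_contra hne
  have hy : 0 < valuation L (((u : 𝒪[L]) : L) - 1) := by
    rw [zero_lt_iff, Ne, map_eq_zero, sub_eq_zero]
    exact fun h => hne (Units.ext (Subtype.ext h))
  obtain ⟨n, hn⟩ := MulArchimedean.arch (valuation L (((u : 𝒪[L]) : L) - 1))⁻¹
    ((one_lt_inv₀ h0).mpr hπ1)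
  rw [inv_pow, inv_le_inv₀ hy (pow_pos h0 n)] at hn
  have h1 := hn.trans (F.valuation_le (hu n))
  exact absurd h1 (not_le.mpr (pow_lt_pow_right_of_lt_one₀ h0 hπ1 (Nat.lt_succ_self n)))

-- Solve the additive problem `Tr z = u - 1` and take `w = 1 + z`; the norm of `w` is `1 + Tr z = u`
-- modulo `M (i + 1)`.
include hπ1 in
theorem exists_norm_approx (hσ : ∀ τ, τ ∈ Subgroup.zpowers σ) (i : ℕ) (u : 𝒪[L]ˣ)
    (hu : u ∈ F.unitSubgroup hπ0 i) (hfix : smulDivHom 𝒪[L]ˣ σ u = 1) :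
    ∃ w ∈ F.unitSubgroup hπ0 i,
      u / smulNormHom Gal(L/K) 𝒪[L]ˣ w ∈ F.unitSubgroup hπ0 (i + 1) := by
  obtain ⟨z, hz, htr⟩ := F.exists_trace_eq i _ hu fun τ => by
    have := (mem_ker_smulDivHom hσ).mp hfix τ
    rw [map_sub, map_one, ← coe_smul_units, this]
  obtain ⟨w, hw, hwz⟩ := F.exists_mem_unitSubgroup hπ0 hπ1 hz
  refine ⟨w, hw, F.div_mem_unitSubgroup hπ0
    (F.unitSubgroup_le_zero hπ0 i (F.smulNormHom_mem_unitSubgroup hπ0 hw)) ?_⟩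
  have := neg_mem (F.norm_sub_mem hπ0 hw)
  rw [hwz, add_sub_cancel_left, htr] at this
  convert this using 1
  ring

-- Norm 1 makes the trace of `y = u - 1` only small, not zero. Subtracting `y' ∈ M (i + 1)` with the
-- same trace allows solving `σ z - z = y - y'`. For `w = 1 + z` the error `u w - σ w` is `y' + y
-- z`.
include hπ1 in
theorem exists_smulDiv_approx (i : ℕ) (u : 𝒪[L]ˣ)
    (hu : u ∈ F.unitSubgroup hπ0 i) (hN : smulNormHom Gal(L/K) 𝒪[L]ˣ u = 1) :
    ∃ w ∈ F.unitSubgroup hπ0 i, u / smulDivHom 𝒪[L]ˣ σ w ∈ F.unitSubgroup hπ0 (i + 1) := by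
  set y : L := ((u : 𝒪[L]) : L) - 1 with hy
  have h1 := neg_mem (F.norm_sub_mem hπ0 hu)
  rw [hN, Units.val_one, Subring.coe_one, ← hy] at h1
  have htr : ∑ τ : Gal(L/K), τ y ∈ F.M (i + 1) := by
    convert h1 using 1
    ring
  obtain ⟨y', hy', htr'⟩ := F.exists_trace_eq (i + 1) _ htr fun ρ => by
    rw [map_sum]
    exact Fintype.sum_equiv (Equiv.mulLeft ρ) _ _ fun τ => by simp
  obtain ⟨z, hz, hz'⟩ := F.exists_sub_eq i (y - y') (sub_mem hu (F.succ_le i hy'))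
    (by simp [htr'])
  obtain ⟨w, hw, hwz⟩ := F.exists_mem_unitSubgroup hπ0 hπ1 hz
  refine ⟨w, hw, ?_⟩
  rw [smulDivHom_apply, div_div_eq_mul_div]
  refine F.div_mem_unitSubgroup hπ0
    (F.unitSubgroup_le_zero hπ0 i (F.smul_mem_unitSubgroup hπ0 σ hw)) ?_
  rw [Units.val_mul, Subring.coe_mul, coe_smul_units, hwz, map_add, map_one]
  have h2 := add_mem hy' (F.mul_mem' (k := i + 1) (by omega) hu hz)
  convert h2 using 1
  linear_combination -hz'

end TrivialFiltration

end Units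

/-! ### The Herbrand quotient of the units. -/

section UnitsHerbrand

variable {K L : Type*} [Field K] [Field L] [ValuativeRel L] [TopologicalSpace L]
  [IsNonarchimedeanLocalField L] [Algebra K L] [FiniteDimensional K L] [IsGalois K L]

omit [FiniteDimensional K L] [IsGalois K L]

theorem continuous_smulNormHom_units [Fintype Gal(L/K)] :
    Continuous (smulNormHom Gal(L/K) 𝒪[L]ˣ) := by
  have : ⇑(smulNormHom Gal(L/K) 𝒪[L]ˣ) = fun u => ∏ τ : Gal(L/K), τ • u :=
    funext smulNormHom_apply
  rw [this]
  exact continuous_finsetProd _ fun τ _ => continuous_smul_units τ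

theorem continuous_smulDivHom_units (σ : Gal(L/K)) : Continuous (smulDivHom 𝒪[L]ˣ σ) :=
  (continuous_smul_units σ).div' continuous_id

end UnitsHerbrand

section UnitsHerbrand

variable {K L : Type*} [Field K] [Field L] [ValuativeRel L] [TopologicalSpace L]
  [IsNonarchimedeanLocalField L]

instance compactSpace_units_integer : CompactSpace 𝒪[L]ˣ := by
  have : T2Space L := by
    let := IsTopologicalAddGroup.rightUniformSpace L
    have := isUniformAddGroup_of_addCommGroup (G := L)
    have : T0Space L := ValuedRing.separated (Γ₀ := ValueGroupWithZero L)
    infer_instance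
  infer_instance

variable [Algebra K L] [FiniteDimensional K L] [IsGalois K L]

/-- The Herbrand quotient of the units of a local field is defined and equal to `1`. -/
theorem units_relIndex_eq {π : K} (hπ0 : π ≠ 0) (hπ1 : valuation L (algebraMap K L π) < 1)
    {σ : Gal(L/K)} (hσ : ∀ τ, τ ∈ Subgroup.zpowers σ) :
    (smulNormHom Gal(L/K) 𝒪[L]ˣ).range.relIndex (smulDivHom 𝒪[L]ˣ σ).ker =
      (smulDivHom 𝒪[L]ˣ σ).range.relIndex (smulNormHom Gal(L/K) 𝒪[L]ˣ).ker ∧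
    (smulDivHom 𝒪[L]ˣ σ).range.relIndex (smulNormHom Gal(L/K) 𝒪[L]ˣ).ker ≠ 0 := by
  have h0 : 0 < valuation L (algebraMap K L π) := zero_lt_iff.mpr (by simpa using hπ0)
  have hπ : ∀ y : L, ∃ n : ℕ, π ^ n • y ∈ 𝒪[L] := by
    intro y
    obtain ⟨n, hn⟩ := MulArchimedean.arch (valuation L y) ((one_lt_inv₀ h0).mpr hπ1)
    refine ⟨n, ?_⟩
    rw [inv_pow, ← mul_one (_ ^ n)⁻¹, le_inv_mul_iff₀ (pow_pos h0 n)] at hn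
    rw [Valuation.mem_integer_iff, Algebra.smul_def, map_mul, map_pow, map_pow]
    exact hn
  obtain ⟨F⟩ := nonempty_trivialFiltration
    (fun (τ : Gal(L/K)) y hy => map_mem_integer (τ : L →+* L) ⟨y, hy⟩) hπ0 hπ1.le hπ hσ
  have hopen := F.isOpen_unitSubgroup hπ0
  have : (F.unitSubgroup hπ0 0).FiniteIndex :=
    by
    have := (F.unitSubgroup hπ0 0).quotient_finite_of_isOpen (hopen 0)
    exact Subgroup.finiteIndex_of_finite_quotient
  refine MonoidHom.relIndex_eq_relIndex_of_exact_on _ _ (smulDivHom_smulNormHom σ)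
    (smulNormHom_smulDivHom σ) (F.unitSubgroup hπ0 0)
    (fun u hu => F.smulDivHom_mem_unitSubgroup hπ0 σ hu)
    (fun u hu => F.smulNormHom_mem_unitSubgroup hπ0 hu) (fun u hu h => ?_) (fun u hu h => ?_)
  · exact exists_apply_eq_of_approx (F.unitSubgroup hπ0) (F.unitSubgroup_succ_le hπ0) hopen
      (F.eq_one_of_forall_mem hπ0 hπ1) _ _ continuous_smulNormHom_units
      (smulDivHom_smulNormHom σ) (F.exists_norm_approx hπ0 hπ1 hσ) hu h
  · exact exists_apply_eq_of_approx (F.unitSubgroup hπ0) (F.unitSubgroup_succ_le hπ0) hopen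
      (F.eq_one_of_forall_mem hπ0 hπ1) _ _ (continuous_smulDivHom_units σ)
      (smulNormHom_smulDivHom σ) (F.exists_smulDiv_approx hπ0 hπ1) hu h

end UnitsHerbrand

/-! ### Hilbert 90 for cyclic extensions. -/

open groupCohomology CategoryTheory

/-- Hilbert's Theorem 90. -/
theorem subsingleton_groupCohomology_one_units_field {K : Type*} {L : Type u} [Field K] [Field L]
    [Algebra K L] [FiniteDimensional K L] :
    Subsingleton (groupCohomology (mulModule Gal(L/K) Lˣ) 1) := by
  refine subsingleton_of_forall_eq 0 fun a => ?_
  refine H1_induction_on a fun x => (H1π_eq_zero_iff _).2 ?_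
  obtain ⟨β, hβ⟩ := isMulCoboundary₁_of_isMulCocycle₁_of_aut_to_units
    (fun τ => Additive.toMul (α := Lˣ) (x.1 τ))
    (fun τ ρ => (mem_cocycles₁_iff x.1).mp x.2 τ ρ)
  exact ⟨Additive.ofMul β, funext fun τ => hβ τ⟩

theorem ker_smulNormHom_units_field {K : Type*} {L : Type u} [Field K] [Field L] [Algebra K L]
    [FiniteDimensional K L] {σ : Gal(L/K)} (hσ : ∀ τ, τ ∈ Subgroup.zpowers σ) :
    (smulNormHom Gal(L/K) Lˣ).ker = (smulDivHom Lˣ σ).range := by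
  refine le_antisymm ?_ ?_
  · have : IsCyclic Gal(L/K) := ⟨σ, hσ⟩
    let : CommGroup Gal(L/K) := IsCyclic.commGroup
    have h1 : Subsingleton (groupCohomology (mulModule Gal(L/K) Lˣ) 1) :=
      subsingleton_groupCohomology_one_units_field
    have h2 := card_groupCohomology_one (M := Lˣ) hσ
    rw [Nat.card_eq_one_iff_unique.mpr ⟨h1, ⟨0⟩⟩] at h2
    exact Subgroup.relIndex_eq_one.mp h2.symm
  · rintro _ ⟨x, rfl⟩
    exact smulNormHom_smulDivHom σ x

/-! ### The normalized valuation and the norm on `Lˣ`. -/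

section

variable (L : Type*) [Field L] [ValuativeRel L] [TopologicalSpace L]
  [IsNonarchimedeanLocalField L]

/-- The normalized valuation of a local field, as a homomorphism to `ℤ`. -/
noncomputable def unitsValuation : Lˣ →* Multiplicative ℤ :=
  (WithZero.unitsWithZeroEquiv (α := Multiplicative ℤ)).toMonoidHom.comp
    (Units.map (((IsNonarchimedeanLocalField.valueGroupWithZeroIsoInt L).toMulEquiv.toMonoidHom).comp
      ((valuation L : Valuation L _) : L →* ValueGroupWithZero L)))

variable {L}

theorem unitsValuation_eq_iff (x y : Lˣ) :
    unitsValuation L x = unitsValuation L y ↔ valuation L (x : L) = valuation L (y : L) := by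
  refine (WithZero.unitsWithZeroEquiv (α := Multiplicative ℤ)).injective.eq_iff.trans ?_
  rw [Units.ext_iff]
  exact (IsNonarchimedeanLocalField.valueGroupWithZeroIsoInt L).injective.eq_iff

theorem unitsValuation_surjective : Function.Surjective (unitsValuation L) := by
  intro k
  obtain ⟨x, hx⟩ := valuation_surjective
    ((IsNonarchimedeanLocalField.valueGroupWithZeroIsoInt L).symm (k : WithZero (Multiplicative ℤ)))
  have hx0 : x ≠ 0 := by
    rintro rfl
    have := congrArg (IsNonarchimedeanLocalField.valueGroupWithZeroIsoInt L) hx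
    simp at this
  refine ⟨Units.mk0 x hx0, ?_⟩
  apply WithZero.unitsWithZeroEquiv.symm.injective
  ext
  simp [unitsValuation, hx]

variable (L) in
/-- The inclusion of the units of the ring of integers. -/
noncomputable def integerUnitsHom : 𝒪[L]ˣ →* Lˣ := Units.map (𝒪[L].subtype : 𝒪[L] →* L)

omit [TopologicalSpace L] [IsNonarchimedeanLocalField L] in
theorem coe_integerUnitsHom (u : 𝒪[L]ˣ) : (integerUnitsHom L u : L) = ((u : 𝒪[L]) : L) := rfl

omit [TopologicalSpace L] [IsNonarchimedeanLocalField L] in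
theorem integerUnitsHom_injective : Function.Injective (integerUnitsHom L) :=
  Units.map_injective Subtype.val_injective

omit [TopologicalSpace L] [IsNonarchimedeanLocalField L] in
theorem mem_range_integerUnitsHom {x : Lˣ} :
    x ∈ (integerUnitsHom L).range ↔ valuation L (x : L) = 1 := by
  constructor
  · rintro ⟨u, rfl⟩
    refine le_antisymm (u : 𝒪[L]).2 ?_
    have h : valuation L (((u⁻¹ : 𝒪[L]ˣ) : 𝒪[L]) : L) ≤ 1 := ((u⁻¹ : 𝒪[L]ˣ) : 𝒪[L]).2
    rw [← coe_integerUnitsHom, map_inv, Units.val_inv_eq_inv_val, map_inv₀] at h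
    exact (inv_le_one₀ (by simp [zero_lt_iff])).mp h
  · intro h
    refine ⟨⟨⟨x, h.le⟩, ⟨((x⁻¹ : Lˣ) : L), ?_⟩, ?_, ?_⟩, ?_⟩
    · rw [Valuation.mem_integer_iff, Units.val_inv_eq_inv_val, map_inv₀, h, inv_one]
    · exact Subtype.ext x.mul_inv
    · exact Subtype.ext x.inv_mul
    · exact Units.ext rfl

theorem range_integerUnitsHom : (integerUnitsHom L).range = (unitsValuation L).ker := by
  ext x
  rw [mem_range_integerUnitsHom, MonoidHom.mem_ker, ← map_one (unitsValuation L),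
    unitsValuation_eq_iff, Units.val_one, map_one]

theorem index_range_powMonoidHom_multiplicative_int (n : ℕ) :
    (powMonoidHom n : Multiplicative ℤ →* Multiplicative ℤ).range.index = n := by
  have h := Int.index_zmultiples (n : ℤ)
  rw [Int.natAbs_natCast] at h
  have e : Subgroup.toAddSubgroup' (powMonoidHom n : Multiplicative ℤ →* Multiplicative ℤ).range =
      AddSubgroup.zmultiples (n : ℤ) := by
    ext x
    rw [Subgroup.mem_toAddSubgroup', AddSubgroup.mem_zmultiples_iff]
    constructor
    · rintro ⟨y, hy⟩
      refine ⟨y.toAdd, ?_⟩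
      rw [smul_eq_mul, mul_comm, ← nsmul_eq_mul]
      exact congrArg Multiplicative.toAdd hy
    · rintro ⟨y, rfl⟩
      refine ⟨Multiplicative.ofAdd y, ?_⟩
      rw [smul_eq_mul, mul_comm, ← nsmul_eq_mul]
      rfl
  rw [← e] at h
  exact h

variable {K : Type*} [Field K] [Algebra K L]

theorem unitsValuation_smul (τ : Gal(L/K)) (x : Lˣ) :
    unitsValuation L (τ • x) = unitsValuation L x := by
  rw [unitsValuation_eq_iff]
  exact valuation_apply τ x

theorem unitsValuation_smulNormHom [Fintype Gal(L/K)] (x : Lˣ) :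
    unitsValuation L (smulNormHom Gal(L/K) Lˣ x) = unitsValuation L x ^ Nat.card Gal(L/K) := by
  rw [smulNormHom_apply, map_prod]
  simp_rw [unitsValuation_smul]
  rw [Finset.prod_const, Finset.card_univ, Nat.card_eq_fintype_card]

/-- Modulo units `Lˣ` is `ℤ`, where the norm acts as multiplication by the group order, so the
subgroup is the preimage of its multiples. -/
theorem index_range_sup_range_smulNormHom [Fintype Gal(L/K)] :
    ((integerUnitsHom L).range ⊔ (smulNormHom Gal(L/K) Lˣ).range).index =
      Nat.card Gal(L/K) := by
  rw [range_integerUnitsHom, sup_comm, ← Subgroup.comap_map_eq,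
    Subgroup.index_comap_of_surjective _ unitsValuation_surjective]
  conv_rhs => rw [← index_range_powMonoidHom_multiplicative_int (Nat.card Gal(L/K))]
  congr 1
  ext k
  constructor
  · rintro ⟨_, ⟨x, rfl⟩, rfl⟩
    exact ⟨unitsValuation L x, (unitsValuation_smulNormHom x).symm⟩
  · rintro ⟨m, rfl⟩
    obtain ⟨x, rfl⟩ := unitsValuation_surjective (L := L) m
    exact ⟨_, ⟨x, rfl⟩, unitsValuation_smulNormHom x⟩

end

/-! ### The norm index. -/

section

variable {K : Type*} {L : Type u} [Field K] [Field L] [ValuativeRel L] [TopologicalSpace L]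
  [IsNonarchimedeanLocalField L] [Algebra K L] [FiniteDimensional K L]

/-- The index of the norm group of a cyclic extension of local fields. -/
theorem relIndex_range_smulNormHom_field [IsGalois K L] {π : K} (hπ0 : π ≠ 0)
    (hπ1 : valuation L (algebraMap K L π) < 1) {σ : Gal(L/K)}
    (hσ : ∀ τ, τ ∈ Subgroup.zpowers σ) :
    (smulNormHom Gal(L/K) Lˣ).range.relIndex (smulDivHom Lˣ σ).ker = Nat.card Gal(L/K) := by
  have hsmul : ∀ (τ : Gal(L/K)) (u : 𝒪[L]ˣ),
      integerUnitsHom L (τ • u) = τ • integerUnitsHom L u := fun τ u => Units.ext rfl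
  rw [← index_range_sup_range_smulNormHom (K := K) (L := L)]
  have hker := ker_smulNormHom_units_field (L := L) hσ
  -- Taken with `f = σ - 1` and `g = N`. An element of unit norm is a unit since `ℤ` is
  -- torsion-free, and `ker N = im(σ-1)` consists of units since `σ` preserves the valuation.
  refine MonoidHom.relIndex_range_ker_eq_index_sup _ _ (smulDivHom 𝒪[L]ˣ σ)
    (smulNormHom Gal(L/K) 𝒪[L]ˣ) (integerUnitsHom L) integerUnitsHom_injective
    (fun u => ?_) (fun u => ?_) (smulDivHom_smulNormHom σ) hker (fun x hx => ?_) ?_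
    (units_relIndex_eq hπ0 hπ1 hσ).1
  · rw [smulDivHom_apply, smulDivHom_apply, map_div, hsmul]
  · rw [smulNormHom_apply, smulNormHom_apply, map_prod]
    simp_rw [hsmul]
  · rw [range_integerUnitsHom, MonoidHom.mem_ker] at hx ⊢
    rw [unitsValuation_smulNormHom] at hx
    exact (pow_eq_one_iff_left Nat.card_pos.ne').mp hx
  · rw [hker]
    rintro _ ⟨x, rfl⟩
    rw [range_integerUnitsHom, MonoidHom.mem_ker, smulDivHom_apply, map_div, unitsValuation_smul,
      div_self']

end

end LocalFieldCohomology

/-! ### The main theorem. -/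

theorem mainTheorem5 {K : Type*} {L : Type u}
    [Field K] [ValuativeRel K] [TopologicalSpace K] [IsNonarchimedeanLocalField K]
    [Field L] [ValuativeRel L] [TopologicalSpace L] [IsNonarchimedeanLocalField L]
    [Algebra K L] [ValuativeExtension K L]
    [FiniteDimensional K L] [IsGalois K L] [IsCyclic Gal(L/K)]
    (n : ℕ) (hn : Module.finrank K L = n) :
    (LocalFieldCohomology.HerbrandDefined
        (LocalFieldCohomology.mulModule Gal(L/K) 𝒪[L]ˣ) ∧
      LocalFieldCohomology.herbrandQuotient
        (LocalFieldCohomology.mulModule Gal(L/K) 𝒪[L]ˣ) = 1) ∧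
    (LocalFieldCohomology.HerbrandDefined
        (LocalFieldCohomology.mulModule Gal(L/K) Lˣ) ∧
      LocalFieldCohomology.herbrandQuotient
        (LocalFieldCohomology.mulModule Gal(L/K) Lˣ) = n) ∧
    Nat.card (groupCohomology (LocalFieldCohomology.mulModule Gal(L/K) Lˣ) 2) = n := by
  obtain ⟨σ, hσ⟩ := IsCyclic.exists_generator (α := Gal(L/K))
  -- Any nonzero `π` of `K` that is topologically small in `L` will do; it need not be a
  -- uniformizer.
  obtain ⟨π, hπ0, hπ1⟩ : ∃ π : K, π ≠ 0 ∧ valuation L (algebraMap K L π) < 1 := by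
    obtain ⟨π, hπ0, hπ1⟩ := Valuation.IsNontrivial.exists_lt_one (v := valuation K)
    refine ⟨π, by simpa using hπ0, ?_⟩
    rw [← (valuation L).vlt_one_iff, ← map_one (algebraMap K L), ValuativeExtension.vlt_iff_vlt,
      (valuation K).vlt_one_iff]
    exact hπ1
  let : CommGroup Gal(L/K) := IsCyclic.commGroup
  have hcard : Nat.card Gal(L/K) = n := by rw [IsGalois.card_aut_eq_finrank, hn]
  have hn0 : n ≠ 0 := hcard ▸ Nat.card_pos.ne'
  obtain ⟨hU, hU0⟩ := LocalFieldCohomology.units_relIndex_eq hπ0 hπ1 hσ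
  have hL := LocalFieldCohomology.relIndex_range_smulNormHom_field hπ0 hπ1 hσ
  rw [hcard] at hL
  have hU1 := LocalFieldCohomology.card_tateCohomology_one (M := 𝒪[L]ˣ) hσ
  have hU2 := LocalFieldCohomology.card_tateCohomology_zero (M := 𝒪[L]ˣ) hσ
  have hL1 := LocalFieldCohomology.card_tateCohomology_one (M := Lˣ) hσ
  have hL2 := LocalFieldCohomology.card_tateCohomology_zero (M := Lˣ) hσ
  have hL3 := LocalFieldCohomology.card_groupCohomology_two (M := Lˣ) hσ
  rw [LocalFieldCohomology.ker_smulNormHom_units_field hσ, Subgroup.relIndex_self] at hL1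
  rw [hL] at hL2 hL3
  rw [hU] at hU2
  refine ⟨⟨⟨?_, ?_⟩, ?_⟩, ⟨⟨?_, ?_⟩, ?_⟩, hL3⟩
  · exact Nat.finite_of_card_ne_zero (hU2.trans_ne hU0)
  · exact Nat.finite_of_card_ne_zero (hU1.trans_ne hU0)
  · have e : LocalFieldCohomology.herbrandQuotient
        (LocalFieldCohomology.mulModule Gal(L/K) 𝒪[L]ˣ) = _ / _ :=
      congrArg₂ (fun a b : ℕ => (a : ℚ) / (b : ℚ)) hU2 hU1
    rw [e]
    exact div_self (Nat.cast_ne_zero.mpr hU0)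
  · exact Nat.finite_of_card_ne_zero (hL2.trans_ne hn0)
  · exact Nat.finite_of_card_ne_zero (hL1.trans_ne one_ne_zero)
  · have e : LocalFieldCohomology.herbrandQuotient
        (LocalFieldCohomology.mulModule Gal(L/K) Lˣ) = _ / _ :=
      congrArg₂ (fun a b : ℕ => (a : ℚ) / (b : ℚ)) hL2 hL1
    rw [e, Nat.cast_one, div_one]
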